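/- Let $G$ be a finite simple graph with an edge-coloring (adjacent edges may receive the same color). A subtree of $G$ is rainbow if no two of its edges share a color. The coloring is a 3-rainbow coloring if for any three (not necessarily distinct) vertices of $G$ there is a rainbow tree in $G$ containing them, and $rx_3(G)$ denotes the minimum number of colors in a 3-rainbow coloring of $G$. (If $G$ has at least three vertices, it is equivalent to consider only three distinct vertices; under this convention $rx_3(K_1)=0$ and $rx_3(K_2)=1$.) A set $D\subseteq V(G)$ is a connected three-way dominating set of $G$ if every vertex outside $D$ has a neighbor in $D$, every vertex outside $D$ has degree at least $3$ in $G$, and the induced subgraph $G[D]$ is connected. **Theorem.** If $D$ is a connected three-way dominating set of a finite connected graph $G$, then $rx_3(G)\le rx_3(G[D])+6$. Moreover, the bound is tight: if $G$ is the French windmill consisting of $t\ge 2\cdot 5^6+1$ copies of $K_4$ that share exactly one common vertex $v_0$, then $G$ is connected, $D=\{v_0\}$ is a connected three-way dominating set of $G$, $rx_3(G[D])=0$, and $rx_3(G)=rx_3(G[D])+6=6$. -/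

import Mathlib

universe u

namespace RainbowIndex

variable {V : Type u}

/-- A subgraph `T` of `G` is rainbow for the edge-coloring `c` if no two edges of `T` share the
same color. Colors are those of `Fin n`; adjacent edges may be colored the same. -/
def IsRainbow {G : SimpleGraph V} {n : ℕ} (c : G.edgeSet → Fin n) (T : G.Subgraph) : Prop :=
  ∀ e f : G.edgeSet, (e : Sym2 V) ∈ T.edgeSet → (f : Sym2 V) ∈ T.edgeSet → c e = c f → e = f

/-- A rainbow `S`-tree: a rainbow subgraph of `G` which is a tree and contains `S`. -/
def IsRainbowTree {G : SimpleGraph V} {n : ℕ} (c : G.edgeSet → Fin n) (S : Set V)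
    (T : G.Subgraph) : Prop :=
  T.coe.IsTree ∧ IsRainbow c T ∧ S ⊆ T.verts

/-- A 3-rainbow coloring: any three vertices are connected by a rainbow tree. The three vertices
need not be distinct. On a graph with at least three vertices it makes no difference whether
repetitions are allowed (see `isThreeRainbow_iff`). With this convention the index of a one-vertex
graph is `0`, and that of a single edge is `1`. -/
def IsThreeRainbow {G : SimpleGraph V} {n : ℕ} (c : G.edgeSet → Fin n) : Prop :=
  ∀ u v w : V, ∃ T : G.Subgraph, IsRainbowTree c {u, v, w} T

/-- The 3-rainbow index: the least number of colors of a 3-rainbow coloring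
(it is `⊤` if there is none, which does not happen for finite connected graphs). -/
noncomputable def rx3 (G : SimpleGraph V) : ℕ∞ :=
  ⨅ n ∈ {n : ℕ | ∃ c : G.edgeSet → Fin n, IsThreeRainbow c}, (n : ℕ∞)

/-- On at least three vertices, a coloring is 3-rainbow iff every set of exactly three vertices
has a rainbow tree. -/
theorem isThreeRainbow_iff [Finite V] (hV : 3 ≤ Nat.card V) {G : SimpleGraph V} {n : ℕ}
    (c : G.edgeSet → Fin n) :
    IsThreeRainbow c ↔ ∀ S : Set V, S.ncard = 3 → ∃ T : G.Subgraph, IsRainbowTree c S T := by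
  constructor
  · intro h S hS
    obtain ⟨x, y, z, -, -, -, rfl⟩ := Set.ncard_eq_three.1 hS
    exact h x y z
  · intro h u v w
    have h3 : ({u, v, w} : Set V).ncard ≤ 3 := by
      refine (Set.ncard_insert_le _ _).trans ?_
      have := Set.ncard_insert_le v {w}
      rw [Set.ncard_singleton] at this
      omega
    obtain ⟨S, hS, -, hc⟩ := Set.exists_subsuperset_card_eq (n := 3)
      (Set.subset_univ ({u, v, w} : Set V)) h3 (by rwa [Set.ncard_univ])
    obtain ⟨T, hT, hR, hST⟩ := h S hc
    exact ⟨T, hT, hR, hS.trans hST⟩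

/-- `D` is a dominating set: every vertex outside `D` has a neighbor in `D`. -/
def IsDominating (G : SimpleGraph V) (D : Set V) : Prop :=
  ∀ v, v ∉ D → ∃ x ∈ D, G.Adj v x

/-- `D` is a connected `k`-way dominating set: it is dominating, every vertex outside `D` has
degree (in `G`) at least `k`, and the induced subgraph `G[D]` is connected. -/
structure IsConnectedWayDominating (G : SimpleGraph V) [G.LocallyFinite] (k : ℕ) (D : Set V) :
    Prop where
  dominating : IsDominating G D
  le_degree : ∀ v, v ∉ D → k ≤ G.degree v
  connected : (G.induce D).Connected

/-- The French windmill: `t` copies of `K₄` sharing one vertex. The shared vertex is `none`,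
the other three vertices of the `i`-th copy are `some (i, 0)`, `some (i, 1)`, `some (i, 2)`. -/
def windmill (t : ℕ) : SimpleGraph (Option (Fin t × Fin 3)) :=
  SimpleGraph.fromRel fun x y => ∀ p ∈ x, ∀ q ∈ y, p.1 = q.1

instance (t : ℕ) : DecidableRel (windmill t).Adj :=
  fun x y => inferInstanceAs (Decidable (x ≠ y ∧
    ((∀ p ∈ x, ∀ q ∈ y, p.1 = q.1) ∨ (∀ p ∈ y, ∀ q ∈ x, p.1 = q.1))))

end RainbowIndex

namespace RainbowIndex

open SimpleGraph

/-- The six additional colors. Legs mostly have colors `inl i`, other edges colors `inr i`. -/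
abbrev Color := ZMod 3 ⊕ ZMod 3

/-- The kinds of vertices outside the dominating set, see `Kind.sets`. -/
abbrev Kind := (ZMod 3 × Bool) ⊕ Fin 4

/-- The three pairwise disjoint sets of colors through which a vertex of the given kind can reach
the dominating set. -/
def Kind.sets : Kind → Fin 3 → Finset Color
  | .inl (i, true) =>
    ![{.inl i}, {.inl (i - 1), .inr i}, {.inl (i + 1), .inr (i + 1), .inr (i + 2)}]
  | .inl (i, false) =>
    ![{.inl i}, {.inl (i - 1), .inr i, .inr (i + 2)}, {.inl (i + 1), .inr (i + 1)}]
  -- The remaining four kinds are for the vertices near the irregular edges of the exceptional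
  -- cycle: the root, the vertex before the far end, the far end, and the vertex closing the cycle.
  | .inr 0 => ![{.inl 0}, {.inl 1, .inr 0}, {.inl 2, .inr 1, .inr 2}]
  | .inr 1 => ![{.inl 2}, {.inl 1, .inr 2}, {.inr 0, .inr 1}]
  | .inr 2 => ![{.inr 1}, {.inl 2, .inr 0}, {.inl 0, .inl 1, .inr 2}]
  | .inr 3 => ![{.inr 0}, {.inl 0, .inl 1}, {.inr 1, .inr 2}]

/-- Any three vertices outside the dominating set can reach it through disjoint color sets. -/
theorem Kind.exists_disjoint : ∀ a b c : Kind, ∃ i j k : Fin 3,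
    Disjoint (Kind.sets a i) (Kind.sets b j) ∧ Disjoint (Kind.sets a i) (Kind.sets c k) ∧
      Disjoint (Kind.sets b j) (Kind.sets c k) := by
  decide +kernel

/-! ### Exits through prescribed color sets -/

section Exit

variable {K : Type*} {H : SimpleGraph K} {l : K → Finset Color} {κ : K → K → Color}

/-- From `v` one can walk along edges of `H`, and then use a leg, so that all the colors are
different and belong to `X`. The legs at `v` have the colors in `l v`, and the edges of `H` are
colored by `κ`. -/
inductive Exit (H : SimpleGraph K) (l : K → Finset Color) (κ : K → K → Color) :
    K → Finset Color → Prop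
  | leg {v i X} : i ∈ l v → i ∈ X → Exit H l κ v X
  | step {v w X} : H.Adj v w → κ v w ∈ X → Exit H l κ w (X.erase (κ v w)) → Exit H l κ v X

/-- The vertex `v` has exits through all three color sets of some kind. -/
def Served (H : SimpleGraph K) (l : K → Finset Color) (κ : K → K → Color) (v : K) : Prop :=
  ∃ k : Kind, ∀ j, Exit H l κ v (k.sets j)

variable (H l κ) in
/-- A short exit to the next class. -/
def Up (cls : K → ZMod 3) (v : K) : Prop :=
  .inl (cls v + 1) ∈ l v ∨ ∃ u, H.Adj v u ∧ cls u = cls v + 1 ∧ κ v u = .inr (cls v + 1)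

variable (H l κ) in
/-- A short exit to the previous class. -/
def Down (cls : K → ZMod 3) (v : K) : Prop :=
  .inl (cls v - 1) ∈ l v ∨ ∃ u, H.Adj v u ∧ cls u = cls v - 1 ∧ κ v u = .inr (cls v)

variable {cls : K → ZMod 3}

theorem Up.exit (hl : ∀ v, .inl (cls v) ∈ l v) {v : K} (h : Up H l κ cls v) {X : Finset Color}
    (h1 : .inl (cls v + 1) ∈ X) (h2 : .inr (cls v + 1) ∈ X) : Exit H l κ v X := by
  obtain h | ⟨u, hu, hc, hk⟩ := h
  · exact .leg h h1
  · refine .step hu (hk ▸ h2) (.leg (i := .inl (cls v + 1)) (hc ▸ hl u) ?_)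
    simp [hk, h1]

theorem Down.exit (hl : ∀ v, .inl (cls v) ∈ l v) {v : K} (h : Down H l κ cls v) {X : Finset Color}
    (h1 : .inl (cls v - 1) ∈ X) (h2 : .inr (cls v) ∈ X) : Exit H l κ v X := by
  obtain h | ⟨u, hu, hc, hk⟩ := h
  · exact .leg h h1
  · refine .step hu (hk ▸ h2) (.leg (i := .inl (cls v - 1)) (hc ▸ hl u) ?_)
    simp [hk, h1]

theorem served_of_up_down (hl : ∀ v, .inl (cls v) ∈ l v) {v : K} (hu : Up H l κ cls v)
    (hd : Down H l κ cls v) : Served H l κ v := by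
  refine ⟨.inl (cls v, true), fun j => ?_⟩
  fin_cases j
  · exact .leg (hl v) (by simp [Kind.sets])
  · exact hd.exit hl (by simp [Kind.sets]) (by simp [Kind.sets])
  · exact hu.exit hl (by simp [Kind.sets]) (by simp [Kind.sets])

theorem zmod_three_facts : ∀ i : ZMod 3, i + 1 ≠ i + 2 ∧ i - 1 = i + 2 ∧ i - 1 - 1 = i + 1 ∧
    i + 1 + 1 = i - 1 ∧ i ≠ i + 2 ∧ i ≠ i + 1 := by decide

/-- This is for a leaf on a positive branch. The parent uses `inr` of the own class, so the other
two `inr` colors remain for reaching a leg of the next class through `a`: sideways then up, or two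
steps down, since two down is one up modulo 3. -/
theorem served_of_down (hl : ∀ v, .inl (cls v) ∈ l v) {v a : K} (hd : Down H l κ cls v)
    (ha : H.Adj v a) (h : cls a = cls v ∧ κ v a = .inr (cls v + 2) ∧ Up H l κ cls a ∨
      cls a = cls v - 1 ∧ κ v a = .inr (cls v + 1) ∧ Down H l κ cls a) : Served H l κ v := by
  obtain ⟨h1, h2, h3, h4, h5, h6⟩ := zmod_three_facts (cls v)
  refine ⟨.inl (cls v, true), fun j => ?_⟩
  fin_cases j
  · exact .leg (hl v) (by simp [Kind.sets])
  · exact hd.exit hl (by simp [Kind.sets]) (by simp [Kind.sets])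
  · obtain ⟨hc, hk, hu⟩ | ⟨hc, hk, hu⟩ := h
    · refine .step ha (by simp [hk, Kind.sets]) (hu.exit hl ?_ ?_)
      · simp [hk, Kind.sets, hc]
      · simp [hk, Kind.sets, hc, h1]
    · refine .step ha (by simp [hk, Kind.sets]) (hu.exit hl ?_ ?_)
      · simp [hk, Kind.sets, hc, h3]
      · simp [hk, Kind.sets, hc, h2, h1.symm]

/-- The mirror image, for leaves on negative branches. Now the parent edge uses `inr (cls v + 1)`,
so the spare color `inr (cls v + 2)` moves to the downward set, which is why a kind carries a
Boolean. -/
theorem served_of_up (hl : ∀ v, .inl (cls v) ∈ l v) {v a : K} (hd : Up H l κ cls v)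
    (ha : H.Adj v a) (h : cls a = cls v ∧ κ v a = .inr (cls v + 2) ∧ Down H l κ cls a ∨
      cls a = cls v + 1 ∧ κ v a = .inr (cls v) ∧ Up H l κ cls a) : Served H l κ v := by
  obtain ⟨h1, h2, h3, h4, h5, h6⟩ := zmod_three_facts (cls v)
  refine ⟨.inl (cls v, false), fun j => ?_⟩
  fin_cases j
  · exact .leg (hl v) (by simp [Kind.sets])
  · obtain ⟨hc, hk, hu⟩ | ⟨hc, hk, hu⟩ := h
    · refine .step ha (by simp [hk, Kind.sets]) (hu.exit hl ?_ ?_)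
      · simp [hk, Kind.sets, hc]
      · simp [hk, Kind.sets, hc, h5]
    · refine .step ha (by simp [hk, Kind.sets]) (hu.exit hl ?_ ?_)
      · simp [hk, Kind.sets, hc, h4]
      · simp [hk, Kind.sets, hc, h2, h4, h5.symm]
  · exact hd.exit hl (by simp [Kind.sets]) (by simp [Kind.sets])

/-- The color of an edge between vertices of classes `i` and `j`. -/
def stdColor (i j : ZMod 3) : Color :=
  if j = i + 1 then .inr j else if i = j + 1 then .inr i else .inr (i + 2)

theorem stdColor_comm : ∀ i j, stdColor i j = stdColor j i := by decide

theorem stdColor_up {i j : ZMod 3} (h : j = i + 1) : stdColor i j = .inr (i + 1) := by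
  subst h; revert i; decide

theorem stdColor_down {i j : ZMod 3} (h : j = i - 1) : stdColor i j = .inr i := by
  subst h; revert i; decide

theorem stdColor_self (i : ZMod 3) : stdColor i i = .inr (i + 2) := by
  revert i; decide

end Exit

/-! ### Signed rooted trees and maximal total depth -/

section Rooted

variable {K : Type*} {H : SimpleGraph K} {r : K} {lam : K → ℤ} {p : K → K}

/-- A rooted spanning tree: `p v` is the parent of `v`, and the absolute value of `lam v` is the
depth of `v`. The sign of `lam` is constant on each branch. -/
structure Rooted (H : SimpleGraph K) (r : K) (lam : K → ℤ) (p : K → K) : Prop where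
  lam_root : lam r = 0
  parent_root : p r = r
  adj : ∀ v, v ≠ r → H.Adj v (p v)
  lam_parent : ∀ v, v ≠ r → 0 < lam v ∧ lam v = lam (p v) + 1 ∨ lam v < 0 ∧ lam v = lam (p v) - 1

theorem Rooted.ne_zero (h : Rooted H r lam p) {v : K} (hv : v ≠ r) : lam v ≠ 0 := by
  have := h.lam_parent v hv; omega

theorem Rooted.eq_root (h : Rooted H r lam p) {v : K} (hv : lam v = 0) : v = r := by
  by_contra h'; exact h.ne_zero h' hv

theorem Rooted.neg (h : Rooted H r lam p) : Rooted H r (fun v => -lam v) p where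
  lam_root := by simp [h.lam_root]
  parent_root := h.parent_root
  adj := h.adj
  lam_parent v hv := by have := h.lam_parent v hv; omega

theorem Rooted.exists_lam_eq (h : Rooted H r lam p) {v : K} {j : ℤ} (h0 : 0 ≤ j)
    (hj : j ≤ lam v) : ∃ u, lam u = j := by
  obtain ⟨n, hn⟩ : ∃ n : ℕ, lam v = j + n := ⟨(lam v - j).toNat, by omega⟩
  induction n generalizing v with
  | zero => exact ⟨v, by simpa using hn⟩
  | succ n ih =>
    have hv : v ≠ r := fun e => by have := h.lam_root; subst e; omega
    have := h.lam_parent v hv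
    exact ih (v := p v) (by omega) (by push_cast at hn; omega)

/-- Walking to the root meets every intermediate depth. The resulting bound makes the total depth
bounded, so that a maximum exists. -/
theorem Rooted.lam_lt_card [Fintype K] (h : Rooted H r lam p) (v : K) :
    lam v < Fintype.card K := by
  classical
  have hs : Finset.Icc 0 (lam v) ⊆ Finset.univ.image lam := fun j hj => by
    rw [Finset.mem_Icc] at hj
    obtain ⟨u, hu⟩ := h.exists_lam_eq hj.1 hj.2
    exact Finset.mem_image.2 ⟨u, Finset.mem_univ _, hu⟩
  have h1 := (Finset.card_le_card hs).trans Finset.card_image_le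
  rw [Int.card_Icc, Finset.card_univ] at h1
  omega

theorem Rooted.natAbs_lam_le_card [Fintype K] (h : Rooted H r lam p) (v : K) :
    (lam v).natAbs ≤ Fintype.card K := by
  have := h.lam_lt_card v
  have := h.neg.lam_lt_card v
  omega

/-- `v` is a leaf of the rooted tree. -/
def Leaf (r : K) (p : K → K) (v : K) : Prop := v ≠ r ∧ ∀ w, p w ≠ v

theorem Rooted.rehang [DecidableEq K] (h : Rooted H r lam p) {v a : K} (hv : Leaf r p v)
    (ha : H.Adj v a) {x : ℤ} (hx : 0 ≤ lam a ∧ x = lam a + 1 ∨ lam a ≤ 0 ∧ x = lam a - 1) :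
    Rooted H r (Function.update lam v x) (Function.update p v a) where
  lam_root := by rw [Function.update_of_ne hv.1.symm, h.lam_root]
  parent_root := by rw [Function.update_of_ne hv.1.symm, h.parent_root]
  adj w hw := by
    by_cases e : w = v
    · subst e; simpa using ha
    · rw [Function.update_of_ne e]; exact h.adj w hw
  lam_parent w hw := by
    by_cases e : w = v
    · subst e
      rw [Function.update_self, Function.update_self, Function.update_of_ne ha.ne']
      omega
    · rw [Function.update_of_ne e, Function.update_of_ne e, Function.update_of_ne (hv.2 w)]
      exact h.lam_parent w hw

/-- The rooted tree is balanced if the root has two legs or branches of both signs. -/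
structure Balanced (H : SimpleGraph K) (L : K → ℕ) (r : K) (lam : K → ℤ) (p : K → K) : Prop
    extends Rooted H r lam p where
  sides : 2 ≤ L r ∨ (∃ v, 0 < lam v) ∧ ∃ v, lam v < 0

variable {L : K → ℕ}

theorem Balanced.neg (h : Balanced H L r lam p) : Balanced H L r (fun v => -lam v) p where
  toRooted := h.toRooted.neg
  sides := h.sides.imp_right fun ⟨⟨v, hv⟩, w, hw⟩ => ⟨⟨w, by omega⟩, v, by omega⟩

/-- A balanced rooted tree of maximal total depth. -/
structure Optimal [Fintype K] (H : SimpleGraph K) (L : K → ℕ) (r : K) (lam : K → ℤ) (p : K → K) :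
    Prop extends Balanced H L r lam p where
  le : ∀ r' lam' p', Balanced H L r' lam' p' → ∑ v, (lam' v).natAbs ≤ ∑ v, (lam v).natAbs

theorem Optimal.neg [Fintype K] (h : Optimal H L r lam p) :
    Optimal H L r (fun v => -lam v) p where
  toBalanced := h.toBalanced.neg
  le r' lam' p' h' := by simpa using h.le r' lam' p' h'

theorem Balanced.exists_optimal [Fintype K] (h : Balanced H L r lam p) :
    ∃ r lam p, Optimal H L r lam p := by
  let S : Set ℕ := {n | ∃ r lam p, Balanced H L r lam p ∧ n = ∑ v, (lam v).natAbs}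
  have hb : BddAbove S := ⟨∑ _v : K, Fintype.card K, by
    rintro n ⟨r, lam, p, h, rfl⟩
    exact Finset.sum_le_sum fun v _ => h.natAbs_lam_le_card v⟩
  obtain ⟨r', lam', p', h', e⟩ := Nat.sSup_mem (s := S) ⟨_, r, lam, p, h, rfl⟩ hb
  refine ⟨r', lam', p', h', fun r₁ lam₁ p₁ h₁ => ?_⟩
  rw [← e]
  exact le_csSup hb ⟨r₁, lam₁, p₁, h₁, rfl⟩

/-- In an optimal tree, a leaf can be moved unless this makes the tree unbalanced. -/
theorem Optimal.natAbs_lt [Fintype K] (h : Optimal H L r lam p) {v a : K} (hv : Leaf r p v)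
    (hf : 2 ≤ L r ∨ ∃ w, w ≠ v ∧ 0 < lam v * lam w) (ha : H.Adj v a) :
    (lam a).natAbs < (lam v).natAbs := by
  classical
  by_contra! hle
  have hv0 := h.ne_zero hv.1
  obtain ⟨x, hx, hx'⟩ : ∃ x, (0 ≤ lam a ∧ x = lam a + 1 ∨ lam a ≤ 0 ∧ x = lam a - 1) ∧
      x.natAbs = (lam a).natAbs + 1 := by
    by_cases h0 : 0 ≤ lam a
    · exact ⟨_, .inl ⟨h0, rfl⟩, by omega⟩
    · exact ⟨_, .inr ⟨by omega, rfl⟩, by omega⟩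
  have hB : Balanced H L r (Function.update lam v x) (Function.update p v a) := by
    refine ⟨h.rehang hv ha hx, ?_⟩
    obtain h2 | ⟨w, hw, hvw⟩ := hf
    · exact .inl h2
    refine h.sides.imp_right ?_
    -- Both signs survive the move: where `v` itself was the witness, `w` has the same sign and
    -- stays in place.
    have key : ∀ u, ∃ u', (0 < lam u → 0 < Function.update lam v x u') ∧
        (lam u < 0 → Function.update lam v x u' < 0) := fun u => by
      by_cases e : u = v
      · refine ⟨w, ?_⟩
        rw [Function.update_of_ne hw, e]
        exact ⟨fun h => by nlinarith, fun h => by nlinarith⟩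
      · exact ⟨u, by rw [Function.update_of_ne e]; exact ⟨id, id⟩⟩
    rintro ⟨⟨u, hu⟩, u', hu'⟩
    obtain ⟨y, hy, -⟩ := key u
    obtain ⟨y', -, hy'⟩ := key u'
    exact ⟨⟨y, hy hu⟩, y', hy' hu'⟩
  refine (h.le _ _ _ hB).not_gt (Finset.sum_lt_sum (fun w _ => ?_) ⟨v, Finset.mem_univ _, ?_⟩)
  · by_cases e : w = v
    · subst e; rw [Function.update_self]; omega
    · rw [Function.update_of_ne e]
  · rw [Function.update_self]; omega

end Rooted

/-! ### The general coloring from a balanced tree -/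

section

variable {K : Type*} {H : SimpleGraph K} {L : K → ℕ}

/-- There are leg colors and edge colors that serve all vertices. -/
def Servable (H : SimpleGraph K) (L : K → ℕ) : Prop :=
  ∃ (l : K → Finset Color) (κ : K → K → Color), (∀ x y, κ x y = κ y x) ∧
    (∀ v, (l v).card ≤ L v) ∧ ∀ v, Served H l κ v

variable {r : K} {lam : K → ℤ} {p : K → K}

/-- The color class of a vertex of a rooted tree. -/
def cls (lam : K → ℤ) (v : K) : ZMod 3 := (lam v : ZMod 3)

/-- `x` and `y` are joined by an edge of the rooted tree. -/
def TreeAdj (p : K → K) (x y : K) : Prop := y = p x ∨ x = p y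

theorem TreeAdj.symm {x y : K} (h : TreeAdj p x y) : TreeAdj p y x := Or.symm h

theorem Rooted.adj_of_treeAdj (h : Rooted H r lam p) {x y : K} (ht : TreeAdj p x y)
    (hxy : lam x ≠ lam y) : H.Adj x y := by
  obtain rfl | rfl := ht
  · exact h.adj x fun e => hxy (by rw [e, h.parent_root])
  · exact (h.adj y fun e => hxy (by rw [e, h.parent_root])).symm

theorem Rooted.exists_child (h : Rooted H r lam p) [Nontrivial K] {v : K} (hv : ¬ Leaf r p v) :
    ∃ w, w ≠ r ∧ p w = v := by
  by_cases e : v = r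
  · subst e
    have key : ∀ n : ℕ, ∀ u, u ≠ v → (lam u).natAbs = n + 1 → ∃ w, w ≠ v ∧ p w = v := by
      intro n
      induction n with
      | zero =>
        intro u hu hn
        have := h.lam_parent u hu
        exact ⟨u, hu, h.eq_root (by omega)⟩
      | succ n ih =>
        intro u hu hn
        have := h.lam_parent u hu
        refine ih (p u) (fun e => ?_) (by omega)
        have h0 := h.lam_root
        rw [← e] at h0
        omega
    obtain ⟨u, hu⟩ := exists_ne v
    have := h.ne_zero hu
    exact key ((lam u).natAbs - 1) u hu (by omega)
  · simp only [Leaf, not_and, not_forall, not_not] at hv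
    obtain ⟨w, hw⟩ := hv e
    exact ⟨w, fun e' => e (by rw [← hw, e', h.parent_root]), hw⟩

theorem Rooted.exists_root_child (h : Rooted H r lam p) {u : K} (hu : 0 < lam u) :
    ∃ w, p w = r ∧ lam w = 1 := by
  obtain ⟨w, hw⟩ := h.exists_lam_eq (j := 1) (by omega) (by omega : 1 ≤ lam u)
  have hr : w ≠ r := fun e => by have := h.lam_root; rw [e] at hw; omega
  have := h.lam_parent w hr
  exact ⟨w, h.eq_root (by omega), hw⟩

theorem Balanced.exists_up (h : Balanced H L r lam p) [Nontrivial K] {v : K}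
    (hv : ¬ Leaf r p v ∨ lam v < 0) (hL : L v < 2) : ∃ u, TreeAdj p v u ∧ lam u = lam v + 1 := by
  by_cases hr : v = r
  · subst hr
    obtain hs | ⟨⟨u, hu⟩, -⟩ := h.sides
    · omega
    obtain ⟨w, hw, hw'⟩ := h.exists_root_child hu
    exact ⟨w, .inr hw.symm, by rw [hw', h.lam_root]; rfl⟩
  have := h.lam_parent v hr
  by_cases hn : lam v < 0
  · exact ⟨p v, .inl rfl, by omega⟩
  · obtain ⟨w, hwr, hw⟩ := h.exists_child (hv.resolve_right hn)
    have h2 := h.lam_parent w hwr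
    rw [hw] at h2
    exact ⟨w, .inr hw.symm, by omega⟩

theorem Balanced.exists_down (h : Balanced H L r lam p) [Nontrivial K] {v : K}
    (hv : ¬ Leaf r p v ∨ 0 < lam v) (hL : L v < 2) : ∃ u, TreeAdj p v u ∧ lam u = lam v - 1 := by
  obtain ⟨u, hu, e⟩ := h.neg.exists_up (v := v) (hv.imp_right fun h => by omega) hL
  exact ⟨u, hu, by omega⟩

theorem Rooted.exists_up_or_down (h : Rooted H r lam p) [Nontrivial K] (v : K) :
    ∃ u, TreeAdj p v u ∧ (lam u = lam v + 1 ∨ lam u = lam v - 1) := by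
  by_cases hv : Leaf r p v
  · have := h.lam_parent v hv.1
    exact ⟨p v, .inl rfl, by omega⟩
  · obtain ⟨w, hwr, hw⟩ := h.exists_child hv
    have := h.lam_parent w hwr
    rw [hw] at this
    exact ⟨w, .inr hw.symm, by omega⟩

theorem zmod_three_cases : ∀ i j : ZMod 3, j = i ∨ j = i + 1 ∨ j = i - 1 := by decide

open Classical in
/-- If the classes of adjacent leaves are not in the wrong order, then all vertices can be served. -/
theorem Balanced.servable (h : Balanced H L r lam p) [Nontrivial K] (hL1 : ∀ v, 1 ≤ L v)
    (hdeg : ∀ v, L v < 2 → ∃ a, H.Adj v a ∧ a ≠ p v)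
    (hleaf : ∀ v a, Leaf r p v → Leaf r p a → H.Adj v a → 0 < lam v →
      lam a < 0 ∧ cls lam a ≠ cls lam v - 1)
    (hleaf' : ∀ v a, Leaf r p v → Leaf r p a → H.Adj v a → lam v < 0 → 0 < lam a) :
    Servable H L := by
  choose! a ha hap using hdeg
  -- `E` marks the leaves whose extra edge leads to the class of the parent, where the standard
  -- color would repeat that of the parent edge. The edge is recolored by `f`. As `a v` is not a
  -- leaf, no edge is claimed from both ends.
  let E : K → Prop := fun v => Leaf r p v ∧ L v < 2 ∧ ¬ Leaf r p (a v) ∧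
    (0 < lam v ∧ cls lam (a v) = cls lam v - 1 ∨ lam v < 0 ∧ cls lam (a v) = cls lam v + 1)
  let f : K → Color := fun v => if 0 < lam v then .inr (cls lam v + 1) else .inr (cls lam v)
  let κ : K → K → Color := fun x y =>
    if TreeAdj p x y then stdColor (cls lam x) (cls lam y)
    else if E x ∧ y = a x then f x
    else if E y ∧ x = a y then f y
    else stdColor (cls lam x) (cls lam y)
  -- A second leg replaces whichever of the two directions the tree may fail to provide.
  let l : K → Finset Color := fun v => if L v < 2 then {.inl (cls lam v)} else
    {.inl (cls lam v), if ∃ u, TreeAdj p v u ∧ lam u = lam v + 1 then .inl (cls lam v - 1)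
      else .inl (cls lam v + 1)}
  have l_one : ∀ {v}, L v < 2 → l v = {.inl (cls lam v)} := fun hv => if_pos hv
  have l_two : ∀ {v}, ¬ L v < 2 → l v = {.inl (cls lam v),
      if ∃ u, TreeAdj p v u ∧ lam u = lam v + 1 then .inl (cls lam v - 1)
      else .inl (cls lam v + 1)} := fun hv => if_neg hv
  have hl : ∀ v, .inl (cls lam v) ∈ l v := fun v => by
    by_cases hv : L v < 2
    · simp [l_one hv]
    · simp [l_two hv]
  have κtree : ∀ {x y}, TreeAdj p x y → κ x y = stdColor (cls lam x) (cls lam y) := fun hxy =>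
    if_pos hxy
  have κE : ∀ {x}, E x → κ x (a x) = f x := fun {x} hx => by
    have h1 : ¬ TreeAdj p x (a x) := by
      rintro (h1 | h1)
      · exact hap x hx.2.1 h1
      · exact hx.1.2 _ h1.symm
    exact (if_neg h1).trans (if_pos ⟨hx, rfl⟩)
  have κstd : ∀ {x y}, ¬ (E x ∧ y = a x) → ¬ (E y ∧ x = a y) →
      κ x y = stdColor (cls lam x) (cls lam y) := fun h1 h2 => by
    simp only [κ, if_neg h1, if_neg h2, ite_self]
  have κsymm : ∀ x y, κ x y = κ y x := fun x y => by
    by_cases ht : TreeAdj p x y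
    · rw [κtree ht, κtree ht.symm, stdColor_comm]
    by_cases h1 : E x ∧ y = a x
    · have h2 : ¬ (E y ∧ x = a y) := fun h2 => h1.1.2.2.1 (h1.2 ▸ h2.1.1)
      simp only [κ, if_neg ht, if_neg (fun h => ht (TreeAdj.symm h) : ¬ TreeAdj p y x), if_pos h1,
        if_neg h2]
    · by_cases h2 : E y ∧ x = a y
      · simp only [κ, if_neg ht, if_neg (fun h => ht (TreeAdj.symm h) : ¬ TreeAdj p y x), if_pos h2,
          if_neg h1]
      · rw [κstd h1 h2, κstd h2 h1, stdColor_comm]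
  have up_of_tree : ∀ {v u}, TreeAdj p v u → lam u = lam v + 1 → Up H l κ (cls lam) v :=
    fun {v u} hu e => by
      have hc : cls lam u = cls lam v + 1 := by simp [cls, e]
      exact .inr ⟨u, h.adj_of_treeAdj hu (by omega), hc, by rw [κtree hu, stdColor_up hc]⟩
  have down_of_tree : ∀ {v u}, TreeAdj p v u → lam u = lam v - 1 → Down H l κ (cls lam) v :=
    fun {v u} hu e => by
      have hc : cls lam u = cls lam v - 1 := by simp [cls, e]
      exact .inr ⟨u, h.adj_of_treeAdj hu (by omega), hc, by rw [κtree hu, stdColor_down hc]⟩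
  have two : ∀ {v}, ¬ L v < 2 → Up H l κ (cls lam) v ∧ Down H l κ (cls lam) v := fun {v} hv => by
    by_cases hu : ∃ u, TreeAdj p v u ∧ lam u = lam v + 1
    · have hu' := hu
      obtain ⟨u, hu1, hu2⟩ := hu'
      exact ⟨up_of_tree hu1 hu2, .inl (by simp [l_two hv, hu])⟩
    · obtain ⟨u, hu1, hu2⟩ := h.exists_up_or_down v
      refine ⟨.inl (by simp [l_two hv, hu]),
        down_of_tree hu1 (hu2.resolve_left fun e => hu ⟨u, hu1, e⟩)⟩
  have up_of : ∀ {v}, ¬ Leaf r p v ∨ lam v < 0 → Up H l κ (cls lam) v := fun {v} hv => by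
    by_cases hL : L v < 2
    · obtain ⟨u, hu1, hu2⟩ := h.exists_up hv hL
      exact up_of_tree hu1 hu2
    · exact (two hL).1
  have down_of : ∀ {v}, ¬ Leaf r p v ∨ 0 < lam v → Down H l κ (cls lam) v := fun {v} hv => by
    by_cases hL : L v < 2
    · obtain ⟨u, hu1, hu2⟩ := h.exists_down hv hL
      exact down_of_tree hu1 hu2
    · exact (two hL).2
  refine ⟨l, κ, κsymm, fun v => ?_, fun v => ?_⟩
  · by_cases hv : L v < 2
    · simpa [l_one hv] using hL1 v
    · refine le_trans ?_ (not_lt.1 hv)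
      rw [l_two hv]
      exact Finset.card_le_two
  by_cases hL : L v < 2
  swap
  · exact served_of_up_down hl (two hL).1 (two hL).2
  by_cases hv : Leaf r p v
  swap
  · exact served_of_up_down hl (up_of (.inl hv)) (down_of (.inl hv))
  have hEa : ¬ (E (a v) ∧ v = a (a v)) := fun h1 => h1.1.2.2.1 (h1.2 ▸ hv)
  obtain hpos | hneg := lt_or_gt_of_ne (h.ne_zero hv.1).symm
  · have hdown := down_of (.inr hpos)
    have hEv : cls lam (a v) ≠ cls lam v - 1 → ¬ (E v ∧ a v = a v) := fun hne hE => by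
      obtain ⟨-, -, -, h1 | h1⟩ := hE.1
      · exact hne h1.2
      · omega
    have hupa : Up H l κ (cls lam) (a v) := up_of <| by
      by_cases hla : Leaf r p (a v)
      · exact .inr (hleaf v _ hv hla (ha v hL) hpos).1
      · exact .inl hla
    obtain hc | hc | hc := zmod_three_cases (cls lam v) (cls lam (a v))
    · refine served_of_down hl hdown (ha v hL) (.inl ⟨hc, ?_, hupa⟩)
      rw [κstd (hEv ?_) hEa, hc, stdColor_self]
      rw [hc]; generalize cls lam v = i; revert i; decide
    · refine served_of_up_down hl (.inr ⟨a v, ha v hL, hc, ?_⟩) hdown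
      rw [κstd (hEv ?_) hEa, stdColor_up hc]
      rw [hc]; generalize cls lam v = i; revert i; decide
    -- The parent edge blocks the class below, so the exit goes over the recolored edge and once
    -- more down, arriving in the class above modulo 3.
    · have hla : ¬ Leaf r p (a v) := fun hla => (hleaf v _ hv hla (ha v hL) hpos).2 hc
      refine served_of_down hl hdown (ha v hL) (.inr ⟨hc, ?_, down_of (.inl hla)⟩)
      rw [κE ⟨hv, hL, hla, .inl ⟨hpos, hc⟩⟩]
      exact if_pos hpos
  · have hup := up_of (.inr hneg)
    have hEv : cls lam (a v) ≠ cls lam v + 1 → ¬ (E v ∧ a v = a v) := fun hne hE => by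
      obtain ⟨-, -, -, h1 | h1⟩ := hE.1
      · omega
      · exact hne h1.2
    have hdowna : Down H l κ (cls lam) (a v) := down_of <| by
      by_cases hla : Leaf r p (a v)
      · exact .inr (hleaf' v _ hv hla (ha v hL) hneg)
      · exact .inl hla
    obtain hc | hc | hc := zmod_three_cases (cls lam v) (cls lam (a v))
    · refine served_of_up hl hup (ha v hL) (.inl ⟨hc, ?_, hdowna⟩)
      rw [κstd (hEv ?_) hEa, hc, stdColor_self]
      rw [hc]; generalize cls lam v = i; revert i; decide
    · have hla : ¬ Leaf r p (a v) := fun hla => by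
        -- The forbidden configuration seen from its negative end: the roles of `v` and `a v` are
        -- exchanged.
        refine (hleaf _ v hla hv (ha v hL).symm (hleaf' v _ hv hla (ha v hL) hneg)).2 ?_
        rw [hc, add_sub_cancel_right]
      refine served_of_up hl hup (ha v hL) (.inr ⟨hc, ?_, up_of (.inl hla)⟩)
      rw [κE ⟨hv, hL, hla, .inr ⟨hneg, hc⟩⟩]
      exact if_neg (by omega)
    · refine served_of_up_down hl hup (.inr ⟨a v, ha v hL, hc, ?_⟩)
      rw [κstd (hEv ?_) hEa, stdColor_down hc]
      rw [hc]; generalize cls lam v = i; revert i; decide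

end

/-! ### The exceptional cycle and existence of an optimal tree -/

section

variable {K : Type*} {H : SimpleGraph K} {L : K → ℕ} {r : K} {lam : K → ℤ} {p : K → K}

open Classical in
/-- A graph with a spanning cycle whose length is `2` modulo `3` can be served. -/
theorem Rooted.servable_of_cycle (h : Rooted H r lam p) (hL1 : ∀ v, 1 ≤ L v) {a v : K}
    (hva : H.Adj v a) (ha : lam a = -1) {d : ℤ} (hv : lam v = d) (hd : 0 < d) (hd3 : 3 ∣ d)
    (hinj : Function.Injective lam) (hrange : ∀ x, x ≠ a → 0 ≤ lam x ∧ lam x ≤ d) :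
    Servable H L := by
  -- The cycle is the path of depths 0 to `d` from `r` to `v`, closed through `a`. Since its length
  -- `d + 2` is not divisible by 3, the periodic pattern fails at `a`; the two edges at `a` and the
  -- legs of `a` and `v` get special colors.
  let κ : K → K → Color := fun x y =>
    if (x = v ∧ y = a) ∨ (x = a ∧ y = v) then .inr 2
    else if (x = a ∧ y = r) ∨ (x = r ∧ y = a) then .inl 1
    else stdColor (cls lam x) (cls lam y)
  let l : K → Finset Color := fun x =>
    if x = a then {.inr 0} else if x = v then {.inr 1} else {.inl (cls lam x)}
  have hr := h.lam_root
  have hav : a ≠ v := by rintro rfl; omega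
  have har : a ≠ r := by rintro rfl; omega
  have hvr : v ≠ r := by rintro rfl; omega
  have hpa : p a = r := h.eq_root (by have := h.lam_parent a har; omega)
  have hra : H.Adj a r := hpa ▸ h.adj a har
  have clsr : cls lam r = 0 := by simp [cls, hr]
  have clsv : cls lam v = 0 := by
    rw [cls, hv]; exact (ZMod.intCast_zmod_eq_zero_iff_dvd d 3).2 hd3
  have la : l a = {.inr 0} := if_pos rfl
  have lv : l v = {.inr 1} := (if_neg hav.symm).trans (if_pos rfl)
  have lx : ∀ {x}, 0 ≤ lam x → lam x < d → .inl (cls lam x) ∈ l x := fun {x} h0 h1 => by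
    have h2 : x ≠ a := by rintro rfl; omega
    have h3 : x ≠ v := by rintro rfl; omega
    simp [l, h2, h3]
  have κva : κ v a = .inr 2 := if_pos (.inl ⟨rfl, rfl⟩)
  have κav : κ a v = .inr 2 := if_pos (.inr ⟨rfl, rfl⟩)
  have κar : κ a r = .inl 1 := (if_neg (by simp [hav, hvr.symm])).trans (if_pos (.inl ⟨rfl, rfl⟩))
  have κra : κ r a = .inl 1 :=
    (if_neg (by simp [har.symm, hvr.symm])).trans (if_pos (.inr ⟨rfl, rfl⟩))
  have κsymm : ∀ x y, κ x y = κ y x := fun x y => by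
    simp only [κ, and_comm, or_comm, stdColor_comm (cls lam x)]
  have par : ∀ {y}, 0 < lam y → H.Adj y (p y) ∧ lam (p y) = lam y - 1 ∧
      cls lam (p y) = cls lam y - 1 ∧ κ y (p y) = .inr (cls lam y) := fun {y} hy => by
    have hyr : y ≠ r := by rintro rfl; omega
    have hlam : lam (p y) = lam y - 1 := by have := h.lam_parent y hyr; omega
    have hya : y ≠ a := by rintro rfl; omega
    have hpya : p y ≠ a := fun e => by rw [e] at hlam; omega
    have hc : cls lam (p y) = cls lam y - 1 := by simp [cls, hlam]
    refine ⟨h.adj y hyr, hlam, hc, ?_⟩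
    simp only [κ, hya, hpya, and_false, false_and, or_self, if_false]
    exact stdColor_down hc
  have chi : ∀ {x}, 0 ≤ lam x → lam x < d → ∃ y, H.Adj x y ∧ lam y = lam x + 1 ∧
      cls lam y = cls lam x + 1 ∧ κ x y = .inr (cls lam x + 1) := fun {x} h0 h1 => by
    obtain ⟨y, hy⟩ := h.exists_lam_eq (j := lam x + 1) (v := v) (by omega) (by omega)
    obtain ⟨h2, h3, h4, h5⟩ := par (y := y) (by omega)
    have e : p y = x := hinj (by omega)
    have hc : cls lam y = cls lam x + 1 := by simp [cls, hy]
    rw [e] at h2 h5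
    exact ⟨y, h2.symm, hy, hc, by rw [κsymm, h5, hc]⟩
  have hrleg : .inl 0 ∈ l r := by have := lx (x := r) (by omega) (by omega); rwa [clsr] at this
  refine ⟨l, κ, κsymm, fun x => le_trans ?_ (hL1 x), fun x => ?_⟩
  · by_cases hxa : x = a
    · simp [hxa, la]
    · by_cases hxv : x = v
      · simp [hxv, lv]
      · simp [l, hxa, hxv]
  by_cases hxa : x = a
  · subst hxa
    refine ⟨.inr 3, fun j => ?_⟩
    fin_cases j
    · exact .leg (i := .inr 0) (by simp [la]) (by simp [Kind.sets])
    · exact .step hra (by simp [κar, Kind.sets]) (.leg hrleg (by simp [κar, Kind.sets]))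
    · exact .step hva.symm (by simp [κav, Kind.sets])
        (.leg (i := .inr 1) (by simp [lv]) (by simp [κav, Kind.sets]; decide))
  obtain ⟨hx0, hxd⟩ := hrange x hxa
  by_cases hxv : x = v
  · subst hxv
    obtain ⟨h1, h2, h3, h4⟩ := par (y := x) (by omega)
    rw [clsv] at h3 h4
    refine ⟨.inr 2, fun j => ?_⟩
    fin_cases j
    · exact .leg (i := .inr 1) (by simp [lv]) (by simp [Kind.sets])
    · exact .step h1 (by simp [h4, Kind.sets])
        (.leg (lx (by omega) (by omega)) (by simp [h3, h4, Kind.sets]; decide))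
    · exact .step hva (by simp [κva, Kind.sets]) (.step hra (by simp [κva, κar, Kind.sets])
        (.leg hrleg (by simp [κva, κar, Kind.sets])))
  have hxd' : lam x < d := lt_of_le_of_ne hxd fun e => hxv (hinj (by omega))
  obtain ⟨y, hy1, hy2, hy3, hy4⟩ := chi hx0 hxd'
  by_cases hxr : x = r
  · subst hxr
    obtain ⟨z, hz1, hz2, hz3, hz4⟩ := chi (x := y) (by omega) (by omega)
    rw [clsr] at hy3 hy4
    rw [hy3] at hz3 hz4
    refine ⟨.inr 0, fun j => ?_⟩
    fin_cases j
    · exact .leg hrleg (by simp [Kind.sets])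
    · exact .step hra.symm (by simp [κra, Kind.sets])
        (.leg (i := .inr 0) (by simp [la]) (by simp [κra, Kind.sets]))
    · refine .step hy1 (by simp [hy4, Kind.sets]) (.step hz1 ?_
        (.leg (lx (by omega) (by omega)) ?_))
      · rw [hy4, hz4]; decide
      · rw [hy4, hz4, hz3]; decide
  have hx0' : 0 < lam x := lt_of_le_of_ne hx0 fun e => hxr (h.eq_root e.symm)
  obtain ⟨h1, h2, h3, h4⟩ := par hx0'
  by_cases hlast : lam x + 1 = d
  · have hyv : y = v := hinj (by omega)
    subst hyv
    have hc : cls lam x = 2 := by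
      rw [clsv] at hy3
      generalize cls lam x = i at hy3; revert i; decide
    rw [hc] at h3 h4 hy4
    refine ⟨.inr 1, fun j => ?_⟩
    fin_cases j
    · exact .leg (lx hx0 hxd') (by simp [hc, Kind.sets])
    · refine .step h1 (by simp [h4, Kind.sets]) (.leg (lx (by omega) (by omega)) ?_)
      rw [h3, h4]; decide
    · refine .step hy1 ?_ (.leg (i := .inr 1) (by simp [lv]) ?_)
      · rw [hy4]; decide
      · rw [hy4]; decide
  refine ⟨.inl (cls lam x, true), fun j => ?_⟩
  fin_cases j
  · exact .leg (lx hx0 hxd') (by simp [Kind.sets])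
  · exact .step h1 (by simp [h4, Kind.sets])
      (.leg (lx (by omega) (by omega)) (by simp [h3, h4, Kind.sets]))
  · exact .step hy1 (by simp [hy4, Kind.sets])
      (.leg (lx (by omega) (by omega)) (by simp [hy3, hy4, Kind.sets]))

open Classical in
/-- If adjacent leaves prevent the general coloring of an optimal tree, then the graph has a
spanning cycle. -/
theorem Optimal.servable_of_leaves [Fintype K] (h : Optimal H L r lam p) (hL1 : ∀ v, 1 ≤ L v)
    {v a : K} (hv : Leaf r p v) (ha : Leaf r p a) (hva : H.Adj v a) (hv0 : 0 < lam v)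
    (ha0 : lam a < 0) (hcls : cls lam a = cls lam v - 1)
    (hsole : ∀ w, lam w < 0 → w = a) : Servable H L := by
  have hr0 := h.lam_root
  have hav : a ≠ v := hva.ne'
  have hvr : v ≠ r := hv.1
  have har : a ≠ r := ha.1
  have hpa : p a = r := by
    have h1 := h.lam_parent a har
    by_contra e
    exact ha.2 a (hsole (p a) (by have := h.ne_zero e; omega))
  have hla : lam a = -1 := by
    have := h.lam_parent a har
    rw [hpa] at this; omega
  have hd3 : (3 : ℤ) ∣ lam v := by
    refine (ZMod.intCast_zmod_eq_zero_iff_dvd _ 3).1 ?_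
    simp only [cls, hla] at hcls
    generalize ((lam v : ℤ) : ZMod 3) = i at *
    push_cast at hcls
    revert i; decide
  have hpos : ∀ x, x ≠ a → x ≠ r → 0 < lam x := fun x hxa hxr => by
    have h1 := h.ne_zero hxr
    by_contra h2
    exact hxa (hsole x (by omega))
  -- Reroot at `a`: the old tree hangs below `a` on the positive side, one level deeper, while `v`
  -- becomes the single negative child of `a`.
  let lam' : K → ℤ := fun x => if x = a then 0 else if x = v then -1 else lam x + 1
  let p' : K → K := fun x => if x = a ∨ x = v ∨ x = r then a else p x
  have lam'a : lam' a = 0 := if_pos rfl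
  have lam'v : lam' v = -1 := (if_neg hav.symm).trans (if_pos rfl)
  have lam'x : ∀ {x}, x ≠ a → x ≠ v → lam' x = lam x + 1 := fun h1 h2 =>
    (if_neg h1).trans (if_neg h2)
  have hB : Balanced H L a lam' p' := by
    refine ⟨⟨lam'a, if_pos (.inl rfl), fun x hx => ?_, fun x hx => ?_⟩,
      .inr ⟨⟨r, by rw [lam'x har.symm hvr.symm]; omega⟩, v, by omega⟩⟩
    · by_cases hxv : x = v
      · simpa [p', hxv] using hva
      · by_cases hxr : x = r
        · simpa [p', hxr] using hpa ▸ (h.adj a har).symm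
        · simpa [p', hx, hxv, hxr] using h.adj x hxr
    · by_cases hxv : x = v
      · simp [p', hxv, lam'a, lam'v]
      · rw [lam'x hx hxv]
        by_cases hxr : x = r
        · simp [p', hxr, lam'a, hr0]
        · have e : p' x = p x := if_neg (by simp [hx, hxv, hxr])
          have h1 := h.lam_parent x hxr
          have h2 := hpos x hx hxr
          rw [e, lam'x (ha.2 x) (hv.2 x)]
          omega
  have hle := h.le _ _ _ hB
  let S : Finset K := (Finset.univ.erase a).erase v
  have memS : ∀ x, x ∈ S ↔ x ≠ v ∧ x ≠ a := fun x => by simp [S]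
  have split : ∀ g : K → ℕ, ∑ x, g x = g a + (g v + ∑ x ∈ S, g x) := fun g => by
    rw [← Finset.add_sum_erase _ g (Finset.mem_univ a),
      ← Finset.add_sum_erase (Finset.univ.erase a) g (a := v) (by simp [hav.symm])]
  rw [split, split, lam'a, lam'v, hla] at hle
  have hS : ∑ x ∈ S, (lam' x).natAbs = ∑ x ∈ S, (lam x).natAbs + S.card := by
    rw [Finset.card_eq_sum_ones, ← Finset.sum_add_distrib]
    refine Finset.sum_congr rfl fun x hx => ?_
    obtain ⟨h1, h2⟩ := (memS x).1 hx
    rw [lam'x h2 h1]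
    by_cases hxr : x = r
    · rw [hxr, hr0]; rfl
    · have := hpos x h2 hxr; omega
  -- Rerooting gains one for each vertex of `S` and loses `lam v - 1` at `v` and one at `a`, so
  -- maximality gives this bound. As all depths from 0 to `lam v - 1` occur in `S`, each occurs
  -- exactly once and the tree is a path.
  have hcard : (S.card : ℤ) ≤ lam v := by omega
  have hsub : Finset.Ico 0 (lam v) ⊆ S.image lam := fun j hj => by
    rw [Finset.mem_Ico] at hj
    obtain ⟨x, hx⟩ := h.exists_lam_eq hj.1 hj.2.le
    refine Finset.mem_image.2 ⟨x, (memS x).2 ⟨?_, ?_⟩, hx⟩ <;> rintro rfl <;> omega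
  have hIco : (Finset.Ico 0 (lam v)).card = (lam v).toNat := by simp
  have himg : (S.image lam).card ≤ S.card := Finset.card_image_le
  have hle' := Finset.card_le_card hsub
  have heq := Finset.eq_of_subset_of_card_le hsub (by omega)
  have hinj : Set.InjOn lam S := Finset.card_image_iff.1 (by omega)
  have hrange : ∀ x ∈ S, 0 ≤ lam x ∧ lam x < lam v := fun x hx =>
    Finset.mem_Ico.1 (heq ▸ Finset.mem_image_of_mem lam hx)
  have hcases : ∀ x, x = a ∨ x = v ∨ x ∈ S := fun x => by
    rw [memS]; tauto
  refine h.toRooted.servable_of_cycle hL1 hva hla rfl hv0 hd3 (fun x y hxy => ?_) fun x hxa => ?_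
  · obtain rfl | rfl | hx := hcases x <;> obtain rfl | rfl | hy := hcases y
    · rfl
    · omega
    · have := hrange y hy; omega
    · omega
    · rfl
    · have := hrange y hy; omega
    · have := hrange x hx; omega
    · have := hrange x hx; omega
    · exact hinj hx hy hxy
  · obtain rfl | rfl | hx := hcases x
    · exact absurd rfl hxa
    · exact ⟨hv0.le, le_rfl⟩
    · exact ⟨(hrange x hx).1, (hrange x hx).2.le⟩

theorem Optimal.servable [Fintype K] [Nontrivial K] (h : Optimal H L r lam p)
    (hL1 : ∀ v, 1 ≤ L v) (hdeg : ∀ v, L v < 2 → ∃ a, H.Adj v a ∧ a ≠ p v) : Servable H L := by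
  -- If both leaves were free to move, each would have to be strictly deeper than the other.
  have hnot : ∀ v a, Leaf r p v → Leaf r p a → H.Adj v a →
      (2 ≤ L r ∨ ∃ w, w ≠ v ∧ 0 < lam v * lam w) → (2 ≤ L r ∨ ∃ w, w ≠ a ∧ 0 < lam a * lam w) →
      False := fun v a hv ha hva h1 h2 =>
    (h.natAbs_lt hv h1 hva).asymm (h.natAbs_lt ha h2 hva.symm)
  have hsign : ∀ v a, Leaf r p v → Leaf r p a → H.Adj v a → ¬ 0 < lam v * lam a :=
    fun v a hv ha hva hpos =>
      hnot v a hv ha hva (.inr ⟨a, hva.ne', hpos⟩) (.inr ⟨v, hva.ne, by rwa [mul_comm]⟩)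
  have hsign1 : ∀ v a, Leaf r p v → Leaf r p a → H.Adj v a → 0 < lam v → lam a < 0 :=
    fun v a hv ha hva h0 => by
      have := h.ne_zero ha.1
      by_contra h1
      exact hsign v a hv ha hva (mul_pos h0 (by omega))
  have hsign2 : ∀ v a, Leaf r p v → Leaf r p a → H.Adj v a → lam v < 0 → 0 < lam a :=
    fun v a hv ha hva h0 => by
      have := h.ne_zero ha.1
      by_contra h1
      exact hsign v a hv ha hva (mul_pos_of_neg_of_neg h0 (by omega))
  by_cases hbad : ∃ v a, Leaf r p v ∧ Leaf r p a ∧ H.Adj v a ∧ 0 < lam v ∧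
      cls lam a = cls lam v - 1
  swap
  · push Not at hbad
    exact h.toBalanced.servable hL1 hdeg
      (fun v a hv ha hva h0 => ⟨hsign1 v a hv ha hva h0, hbad v a hv ha hva h0⟩) hsign2
  obtain ⟨v, a, hv, ha, hva, hv0, hc⟩ := hbad
  have ha0 := hsign1 v a hv ha hva hv0
  have hfree := hnot v a hv ha hva
  by_cases hr : 2 ≤ L r
  · exact (hfree (.inl hr) (.inl hr)).elim
  by_cases hsole : ∀ w, lam w < 0 → w = a
  · exact h.servable_of_leaves hL1 hv ha hva hv0 ha0 hc hsole
  · push Not at hsole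
    obtain ⟨w, hw, hwa⟩ := hsole
    -- Here `a` is not the only negative vertex, so `v` must be the only positive one; flipping all
    -- signs reduces to the previous case.
    refine h.neg.servable_of_leaves hL1 ha hv hva.symm (by omega) (by omega) ?_ fun x hx => ?_
    · simp only [cls] at *
      push_cast
      rw [hc]; ring
    · by_contra hxv
      exact hfree (.inr ⟨x, hxv, mul_pos hv0 (by omega)⟩)
        (.inr ⟨w, hwa, mul_pos_of_neg_of_neg ha0 hw⟩)

theorem exists_rooted (hc : H.Connected) (r : K) :
    ∃ lam p, Rooted H r lam p ∧ ∀ v, 0 ≤ lam v := by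
  have key : ∀ v, ∃ u, (v = r → u = r) ∧ (v ≠ r → H.Adj v u ∧ H.dist v r = H.dist u r + 1) :=
    fun v => by
      by_cases hv : v = r
      · exact ⟨r, fun _ => rfl, fun h => (h hv).elim⟩
      · obtain ⟨q, hq⟩ := hc.exists_walk_length_eq_dist v r
        cases q with
        | nil => exact (hv rfl).elim
        | @cons _ u _ huv q =>
          refine ⟨u, fun h => (hv h).elim, fun _ => ⟨huv, ?_⟩⟩
          have h1 := dist_le q
          have h2 := hc.dist_triangle (u := v) (v := u) (w := r)
          rw [dist_eq_one_iff_adj.2 huv] at h2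
          rw [Walk.length_cons] at hq
          omega
  choose p hp1 hp2 using key
  refine ⟨fun v => H.dist v r, p, ⟨by simp, hp1 r rfl, fun v hv => (hp2 v hv).1, fun v hv => ?_⟩,
    fun v => by positivity⟩
  have := (hp2 v hv).2
  omega

open Classical in
theorem exists_balanced [Finite K] [Nontrivial K] (hc : H.Connected)
    (hdeg : ∀ v u, L v < 2 → ∃ a, H.Adj v a ∧ a ≠ u) : ∃ r lam p, Balanced H L r lam p := by
  by_cases hr : ∃ r, 2 ≤ L r
  · obtain ⟨r, hr⟩ := hr
    obtain ⟨lam, p, h, -⟩ := exists_rooted hc r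
    exact ⟨r, lam, p, h, .inl hr⟩
  push Not at hr
  -- With single legs everywhere, remove a non-cut vertex `v`, root the rest positively at a
  -- neighbor `r` of `v`, and hang `v` from `r` as the negative branch. A second neighbor of `v`
  -- shows that the positive side is nonempty.
  obtain ⟨v, hv⟩ := hc.exists_connected_induce_compl_singleton_of_finite_nontrivial
  obtain ⟨r, hvr, -⟩ := hdeg v v (hr v)
  obtain ⟨y, hvy, hyr⟩ := hdeg v r (hr v)
  obtain ⟨lam, p, h, hnn⟩ := exists_rooted hv ⟨r, hvr.ne'⟩
  have hrv : r ≠ v := hvr.ne'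
  refine ⟨r, fun x => if hx : x = v then -1 else lam ⟨x, hx⟩,
    fun x => if hx : x = v then r else p ⟨x, hx⟩, ⟨?_, ?_, fun x hx => ?_, fun x hx => ?_⟩,
    .inr ⟨⟨y, ?_⟩, v, by simp⟩⟩
  · simpa [hrv] using h.lam_root
  · simpa [hrv] using congrArg Subtype.val h.parent_root
  · by_cases hxv : x = v
    · simpa [hxv] using hvr
    · simpa [hxv] using h.adj ⟨x, hxv⟩ (by simpa [Subtype.ext_iff] using hx)
  · by_cases hxv : x = v
    · subst hxv
      have := h.lam_root
      simp [hrv, this]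
    · have h1 := h.lam_parent ⟨x, hxv⟩ (by simpa [Subtype.ext_iff] using hx)
      have h2 := (p ⟨x, hxv⟩).2
      simp only [Set.mem_compl_iff, Set.mem_singleton_iff] at h2
      simpa [hxv, h2] using h1
  · have h1 := h.ne_zero (v := ⟨y, hvy.ne'⟩) (by simpa [Subtype.ext_iff] using hyr)
    have h2 := hnn ⟨y, hvy.ne'⟩
    have h3 : y ≠ v := hvy.ne'
    simp only [h3, dif_neg, not_false_eq_true]
    omega

/-- A connected graph all of whose vertices have legs, and whose degrees are at least three when
the legs are counted, can be served. -/
theorem servable_of_connected [Finite K] (hc : H.Connected) (hL1 : ∀ v, 1 ≤ L v)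
    (h3 : ∀ v, 3 ≤ L v + (H.neighborSet v).ncard) : Servable H L := by
  cases nonempty_fintype K
  have hnbr : ∀ v u, L v < 2 → ∃ a, H.Adj v a ∧ a ≠ u := fun v u hv => by
    have h2 := h3 v
    obtain ⟨a, ha, hau⟩ := Set.exists_ne_of_one_lt_ncard (s := H.neighborSet v) (by omega) u
    exact ⟨a, ha, hau⟩
  obtain hK | hK := subsingleton_or_nontrivial K
  -- An isolated vertex has at least three legs, one for each set of its kind.
  · refine ⟨fun _ => {.inl 0, .inl 1, .inl 2}, fun _ _ => .inl 0, fun _ _ => rfl, fun v => ?_,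
      fun v => ⟨.inl (0, true), fun j => ?_⟩⟩
    · have h2 : H.neighborSet v = ∅ := Set.eq_empty_of_forall_notMem fun w hw =>
        H.ne_of_adj hw (Subsingleton.elim _ _)
      have := h3 v
      rw [h2, Set.ncard_empty] at this
      exact Finset.card_le_three.trans this
    · fin_cases j
      · exact .leg (i := .inl 0) (by decide) (by decide)
      · exact .leg (i := .inl 2) (by decide) (by decide)
      · exact .leg (i := .inl 1) (by decide) (by decide)
  · obtain ⟨r, lam, p, h⟩ := exists_balanced hc hnbr
    obtain ⟨r, lam, p, h⟩ := h.exists_optimal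
    exact h.servable hL1 fun v => hnbr v (p v)

end

/-! ### Assembling the coloring of the whole graph -/

section

variable {V : Type*} {G : SimpleGraph V}

theorem exists_isTree_subgraph {U : G.Subgraph} (hU : U.Connected) :
    ∃ T : G.Subgraph, T ≤ U ∧ T.verts = U.verts ∧ T.coe.IsTree := by
  obtain ⟨T, hT, htree⟩ := hU.coe.exists_isTree_le
  let T' : G.Subgraph :=
    { verts := U.verts
      Adj := fun x y => ∃ (hx : x ∈ U.verts) (hy : y ∈ U.verts), T.Adj ⟨x, hx⟩ ⟨y, hy⟩
      adj_sub := fun ⟨_, _, h⟩ => U.adj_sub (hT h)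
      edge_vert := fun ⟨hx, _, _⟩ => hx
      symm := ⟨fun _ _ ⟨hx, hy, h⟩ => ⟨hy, hx, h.symm⟩⟩ }
  have e : T'.coe = T := by
    ext ⟨x, hx⟩ ⟨y, hy⟩
    exact ⟨fun ⟨_, _, h⟩ => h, fun h => ⟨hx, hy, h⟩⟩
  refine ⟨T', ⟨le_rfl, ?_⟩, rfl, e ▸ htree⟩
  rintro x y ⟨hx, hy, h⟩
  exact hT h

theorem connected_map {V' : Type*} {G' : SimpleGraph V'} (f : G →g G') {T : G.Subgraph}
    (hT : T.Connected) : (T.map f).Connected := by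
  refine ⟨Connected.map (G := T.coe)
    ⟨fun x => ⟨f x, Set.mem_image_of_mem f x.2⟩, fun {x y} h => ?_⟩ ?_ hT.coe⟩
  · exact ⟨x, y, h, rfl, rfl⟩
  · rintro ⟨_, x, hx, rfl⟩
    exact ⟨⟨x, hx⟩, rfl⟩

/-- The vertex `v` is joined to `D` by a connected subgraph all of whose edges have an end outside
`D` and have different colors in `X`. -/
def Attached (G : SimpleGraph V) (D : Set V) (c : Sym2 V → Color) (v : V) (X : Finset Color) :
    Prop :=
  ∃ S : G.Subgraph, S.Connected ∧ v ∈ S.verts ∧ (∃ d ∈ D, d ∈ S.verts) ∧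
    (∀ e ∈ S.edgeSet, (∃ x ∈ e, x ∉ D) ∧ c e ∈ X) ∧ Set.InjOn c S.edgeSet

theorem attached_of_mem {D : Set V} (c : Sym2 V → Color) {v : V} (hv : v ∈ D) (X : Finset Color) :
    Attached G D c v X :=
  ⟨G.singletonSubgraph v, Subgraph.singletonSubgraph_connected, by simp, ⟨v, hv, by simp⟩,
    by simp, by simp⟩

theorem Exit.attached {K : Type*} {H : SimpleGraph K} {l : K → Finset Color} {κ : K → K → Color}
    {D : Set V} {c : Sym2 V → Color} {φ : K → V} (hφ : ∀ x, φ x ∉ D)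
    (hadj : ∀ {x y}, H.Adj x y → G.Adj (φ x) (φ y) ∧ c s(φ x, φ y) = κ x y)
    (hleg : ∀ {x i}, i ∈ l x → ∃ d ∈ D, G.Adj (φ x) d ∧ c s(φ x, d) = i) {v : K}
    {X : Finset Color} (h : Exit H l κ v X) : Attached G D c (φ v) X := by
  induction h with
  | @leg v i X hi hX =>
    obtain ⟨d, hd, had, hc⟩ := hleg hi
    refine ⟨G.subgraphOfAdj had, Subgraph.subgraphOfAdj_connected had, by simp, ⟨d, hd, by simp⟩,
      ?_, by simp⟩
    intro e he
    rw [edgeSet_subgraphOfAdj, Set.mem_singleton_iff] at he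
    subst he
    exact ⟨⟨φ v, by simp, hφ v⟩, hc ▸ hX⟩
  | @step v w X hvw hX _ ih =>
    obtain ⟨S, hS, hw, ⟨d, hd, hdS⟩, hcol, hinj⟩ := ih
    obtain ⟨ha, hc⟩ := hadj hvw
    refine ⟨G.subgraphOfAdj ha ⊔ S, Subgraph.connected_sup
      (Subgraph.subgraphOfAdj_connected ha).preconnected hS.preconnected ⟨φ w, by simp [hw]⟩,
      .inl (by simp), ⟨d, hd, .inr hdS⟩, fun e he => ?_, ?_⟩
    · rw [Subgraph.edgeSet_sup, edgeSet_subgraphOfAdj] at he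
      obtain rfl | he := he
      · exact ⟨⟨φ v, by simp, hφ v⟩, hc ▸ hX⟩
      · exact ⟨(hcol e he).1, Finset.mem_of_mem_erase (hcol e he).2⟩
    · rw [Subgraph.edgeSet_sup, edgeSet_subgraphOfAdj]
      have hne : ∀ e ∈ S.edgeSet, c e ≠ c s(φ v, φ w) := fun e he => by
        rw [hc]; exact Finset.ne_of_mem_erase (hcol e he).2
      rintro e (rfl | he) f (rfl | hf) hef
      · rfl
      · exact (hne f hf hef.symm).elim
      · exact (hne e he hef).elim
      · exact hinj he hf hef

/-- Turns an abstract set of leg colors into a coloring of actual edges to `D`: distinct colors go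
to distinct neighbors, surplus edges get a default color. -/
theorem exists_colors_onto {N : Set V} (hN : N.Finite) {s : Finset Color} (hs : s.card ≤ N.ncard) :
    ∃ g : V → Color, ∀ i ∈ s, ∃ d ∈ N, g d = i := by
  have := hN.to_subtype
  cases nonempty_fintype N
  obtain ⟨f⟩ : Nonempty (s ↪ N) := Function.Embedding.nonempty_of_card_le (by
    rwa [Fintype.card_coe, ← Nat.card_eq_fintype_card, Nat.card_coe_set_eq])
  have hf : Function.Injective fun i : s => (f i : V) := Subtype.val_injective.comp f.injective
  exact ⟨Function.extend (fun i : s => (f i : V)) (fun i => i.1) fun _ => default,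
    fun i hi => ⟨f ⟨i, hi⟩, (f ⟨i, hi⟩).2, hf.extend_apply _ _ ⟨i, hi⟩⟩⟩

open Classical in
/-- The edges with an end outside a connected three-way dominating set can be colored with six
colors so that all vertices outside are served. -/
theorem exists_attached [Fintype V] [DecidableRel G.Adj] {D : Set V}
    (hdom : IsDominating G D) (hdeg : ∀ v, v ∉ D → 3 ≤ G.degree v) :
    ∃ c : Sym2 V → Color, ∀ v, ∃ k : Kind, ∀ j, Attached G D c v (k.sets j) := by
  let H := G.induce Dᶜ
  have hserv : ∀ C : H.ConnectedComponent,
      Servable C.toSimpleGraph fun v => (G.neighborSet v.1.1 ∩ D).ncard := fun C => by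
    refine servable_of_connected C.connected_toSimpleGraph (fun v => ?_) fun v => ?_
    · obtain ⟨d, hd, had⟩ := hdom v.1.1 v.1.2
      exact (Set.ncard_pos (Set.toFinite _)).2 ⟨d, had, hd⟩
    · have h1 := hdeg v.1.1 v.1.2
      have h2 : (G.neighborSet v.1.1).ncard = G.degree v.1.1 := by
        rw [Set.ncard_eq_toFinset_card', Set.toFinset_card, card_neighborSet_eq_degree]
      have h3 : G.neighborSet v.1.1 ⊆ (G.neighborSet v.1.1 ∩ D) ∪
          (fun x => x.1.1) '' C.toSimpleGraph.neighborSet v := fun w hw => by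
        by_cases hwD : w ∈ D
        · exact .inl ⟨hw, hwD⟩
        · have hadj : H.Adj v.1 ⟨w, hwD⟩ := hw
          exact .inr ⟨⟨⟨w, hwD⟩, C.mem_supp_of_adj_mem_supp v.2 hadj⟩, hadj, rfl⟩
      have h4 := (Set.ncard_le_ncard h3 (Set.toFinite _)).trans (Set.ncard_union_le _ _)
      have h5 := Set.ncard_image_le (f := fun x => x.1.1)
        (Set.toFinite (C.toSimpleGraph.neighborSet v))
      omega
  choose l κ hsymm hcard hserved using hserv
  let comp : (Dᶜ : Set V) → H.ConnectedComponent := H.connectedComponentMk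
  have hg : ∀ x : (Dᶜ : Set V), ∃ g : V → Color, ∀ i ∈ l (comp x) ⟨x, rfl⟩,
      ∃ d ∈ G.neighborSet x ∩ D, g d = i := fun x =>
    exists_colors_onto (Set.toFinite _) (hcard (comp x) ⟨x, rfl⟩)
  choose g hg using hg
  let κ' : (Dᶜ : Set V) → (Dᶜ : Set V) → Color := fun x y =>
    if h : comp y = comp x then κ (comp x) ⟨x, rfl⟩ ⟨y, h⟩ else default
  have hκ' : ∀ {C x y} (hx : comp x = C) (hy : comp y = C), κ' x y = κ C ⟨x, hx⟩ ⟨y, hy⟩ := by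
    rintro _ x y rfl hy
    exact dif_pos hy
  have hl : ∀ {C x i} (hx : comp x = C), i ∈ l C ⟨x, hx⟩ → i ∈ l (comp x) ⟨x, rfl⟩ := by
    rintro _ x i rfl hi
    exact hi
  have κ'symm : ∀ x y, κ' x y = κ' y x := fun x y => by
    by_cases h : comp y = comp x
    · rw [hκ' rfl h, hκ' h rfl, hsymm]
    · simp only [κ', dif_neg h, dif_neg (Ne.symm h)]
  let cp : V → V → Color := fun x y =>
    if hx : x ∈ D then if hy : y ∈ D then default else g ⟨y, hy⟩ x
    else if hy : y ∈ D then g ⟨x, hx⟩ y else κ' ⟨x, hx⟩ ⟨y, hy⟩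
  have cpsymm : ∀ x y, cp x y = cp y x := fun x y => by
    by_cases hx : x ∈ D <;> by_cases hy : y ∈ D <;> simp only [cp, hx, hy, dite_true, dite_false]
    exact κ'symm _ _
  let c : Sym2 V → Color := Sym2.lift ⟨cp, cpsymm⟩
  refine ⟨c, fun v => ?_⟩
  by_cases hv : v ∈ D
  -- A vertex of `D` is attached without any edge, so every kind works.
  · exact ⟨.inr 0, fun j => attached_of_mem c hv _⟩
  obtain ⟨k, hk⟩ := hserved (comp ⟨v, hv⟩) ⟨⟨v, hv⟩, rfl⟩
  refine ⟨k, fun j => (hk j).attached (φ := fun x => x.1.1) (fun x => x.1.2)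
    (fun {x y} hxy => ⟨hxy, ?_⟩) fun {x i} hi => ?_⟩
  · have h1 : cp x y = κ' x.1 y.1 := by
      have hx : (x : V) ∉ D := x.1.2
      have hy : (y : V) ∉ D := y.1.2
      simp only [cp, hx, hy, dite_false]
    exact h1.trans (hκ' x.2 y.2)
  · obtain ⟨x, hx⟩ := x
    obtain ⟨d, ⟨had, hd⟩, hgd⟩ := hg x i (hl hx hi)
    refine ⟨d, hd, had, ?_⟩
    have h1 : cp x d = g x d := by
      have hx : (x : V) ∉ D := x.2
      simp only [cp, hx, hd, dite_true, dite_false]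
    exact h1.trans hgd

open Classical in
theorem exists_isThreeRainbow_add_six [Fintype V] [DecidableRel G.Adj] {D : Set V}
    (hdom : IsDominating G D) (hdeg : ∀ v, v ∉ D → 3 ≤ G.degree v) {n : ℕ}
    (b : (G.induce D).edgeSet → Fin n) (hb : IsThreeRainbow b) :
    ∃ c : G.edgeSet → Fin (n + 6), IsThreeRainbow c := by
  obtain ⟨c, hc⟩ := exists_attached hdom hdeg
  choose k hk using hc
  let ε : Color ≃ Fin 6 := Fintype.equivFinOfCardEq rfl
  let inc : Sym2 D → Sym2 V := Sym2.map Subtype.val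
  have hinc : Function.Injective inc := Sym2.map.injective Subtype.val_injective
  -- Edges inside `D` keep their old colors and all others use the last six, so the two parts of a
  -- tree never clash.
  let F : G.edgeSet → Fin (n + 6) := fun e =>
    if h : ∃ e' : (G.induce D).edgeSet, inc e' = e then Fin.castAdd 6 (b h.choose)
    else Fin.natAdd n (ε (c e))
  have F_in : ∀ (e : G.edgeSet) (e' : (G.induce D).edgeSet), inc e' = e →
      F e = Fin.castAdd 6 (b e') := fun e e' he => by
    have h : ∃ e' : (G.induce D).edgeSet, inc e' = e := ⟨e', he⟩
    have h1 : h.choose = e' := Subtype.ext (hinc (h.choose_spec.trans he.symm))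
    simp only [F, dif_pos h, h1]
  have F_out : ∀ e : G.edgeSet, (∃ x ∈ (e : Sym2 V), x ∉ D) → F e = Fin.natAdd n (ε (c e)) := by
    rintro e ⟨x, hx, hxD⟩
    refine dif_neg ?_
    rintro ⟨e', he'⟩
    rw [← he'] at hx
    obtain ⟨y, -, rfl⟩ := Sym2.mem_map.1 hx
    exact hxD y.2
  refine ⟨F, fun u v w => ?_⟩
  obtain ⟨i, j, m, hij, him, hjm⟩ := Kind.exists_disjoint (k u) (k v) (k w)
  obtain ⟨S₁, hS₁, hu, ⟨d₁, hd₁, hdS₁⟩, hcol₁, hinj₁⟩ := hk u i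
  obtain ⟨S₂, hS₂, hv, ⟨d₂, hd₂, hdS₂⟩, hcol₂, hinj₂⟩ := hk v j
  obtain ⟨S₃, hS₃, hw, ⟨d₃, hd₃, hdS₃⟩, hcol₃, hinj₃⟩ := hk w m
  obtain ⟨T, hT, hTR, hTd⟩ := hb ⟨d₁, hd₁⟩ ⟨d₂, hd₂⟩ ⟨d₃, hd₃⟩
  let T' := T.map (Embedding.induce D).toHom
  have hT' : T'.Connected := connected_map _ ⟨hT.connected⟩
  have hdT : d₁ ∈ T'.verts ∧ d₂ ∈ T'.verts ∧ d₃ ∈ T'.verts :=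
    ⟨⟨⟨d₁, hd₁⟩, hTd (by simp), rfl⟩, ⟨⟨d₂, hd₂⟩, hTd (by simp), rfl⟩,
      ⟨⟨d₃, hd₃⟩, hTd (by simp), rfl⟩⟩
  have hU₁ := Subgraph.connected_sup hT'.preconnected hS₁.preconnected ⟨d₁, hdT.1, hdS₁⟩
  have hU₂ := Subgraph.connected_sup hU₁.preconnected hS₂.preconnected ⟨d₂, .inl hdT.2.1, hdS₂⟩
  have hU₃ := Subgraph.connected_sup hU₂.preconnected hS₃.preconnected
    ⟨d₃, .inl (.inl hdT.2.2), hdS₃⟩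
  obtain ⟨R, hRU, hRv, hR⟩ := exists_isTree_subgraph hU₃
  refine ⟨R, hR, ?_, ?_⟩
  swap
  · rw [hRv]
    rintro x (rfl | rfl | rfl)
    · exact .inl (.inl (.inr hu))
    · exact .inl (.inr hv)
    · exact .inr hw
  have hedge : ∀ e : G.edgeSet, (e : Sym2 V) ∈ R.edgeSet →
      (∃ e' : (G.induce D).edgeSet, (e' : Sym2 D) ∈ T.edgeSet ∧ inc e' = e) ∨
      ((e : Sym2 V) ∈ S₁.edgeSet ∨ (e : Sym2 V) ∈ S₂.edgeSet ∨ (e : Sym2 V) ∈ S₃.edgeSet) :=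
    fun e he => by
      have h1 := Subgraph.edgeSet_mono hRU he
      simp only [Subgraph.edgeSet_sup, Set.mem_union, T', Subgraph.edgeSet_map] at h1
      obtain ((⟨e', he', h⟩ | h) | h) | h := h1
      · exact .inl ⟨⟨e', T.edgeSet_subset he'⟩, he', h⟩
      · exact .inr (.inl h)
      · exact .inr (.inr (.inl h))
      · exact .inr (.inr (.inr h))
  have hout : ∀ e : G.edgeSet, ((e : Sym2 V) ∈ S₁.edgeSet ∨ (e : Sym2 V) ∈ S₂.edgeSet ∨
      (e : Sym2 V) ∈ S₃.edgeSet) → F e = Fin.natAdd n (ε (c e)) := by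
    rintro e (h | h | h)
    · exact F_out e (hcol₁ e h).1
    · exact F_out e (hcol₂ e h).1
    · exact F_out e (hcol₃ e h).1
  have hdisj : ∀ {X Y : Finset Color}, Disjoint X Y → ∀ {x y}, x ∈ X → y ∈ Y → x ≠ y :=
    fun h _ _ hx hy => Finset.disjoint_left.1 h hx |> fun h' e => h' (e ▸ hy)
  intro e f he hf hef
  obtain ⟨e', he', hee⟩ | he := hedge e he <;> obtain ⟨f', hf', hff⟩ | hf := hedge f hf
  · rw [F_in e e' hee, F_in f f' hff] at hef
    have := hTR e' f' he' hf' (Fin.castAdd_injective n 6 hef)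
    exact Subtype.ext (by rw [← hee, ← hff, this])
  · rw [F_in e e' hee, hout f hf] at hef
    have := congrArg Fin.val hef
    simp only [Fin.val_castAdd, Fin.val_natAdd] at this
    omega
  · rw [F_in f f' hff, hout e he] at hef
    have := congrArg Fin.val hef
    simp only [Fin.val_castAdd, Fin.val_natAdd] at this
    omega
  · rw [hout e he, hout f hf] at hef
    have hef := ε.injective (Fin.natAdd_injective 6 n hef)
    apply Subtype.ext
    obtain he | he | he := he <;> obtain hf | hf | hf := hf
    · exact hinj₁ he hf hef
    · exact (hdisj hij (hcol₁ _ he).2 (hcol₂ _ hf).2 hef).elim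
    · exact (hdisj him (hcol₁ _ he).2 (hcol₃ _ hf).2 hef).elim
    · exact (hdisj hij (hcol₁ _ hf).2 (hcol₂ _ he).2 hef.symm).elim
    · exact hinj₂ he hf hef
    · exact (hdisj hjm (hcol₂ _ he).2 (hcol₃ _ hf).2 hef).elim
    · exact (hdisj him (hcol₁ _ hf).2 (hcol₃ _ he).2 hef.symm).elim
    · exact (hdisj hjm (hcol₂ _ hf).2 (hcol₃ _ he).2 hef.symm).elim
    · exact hinj₃ he hf hef

theorem rx3_le {n : ℕ} {c : G.edgeSet → Fin n} (hc : IsThreeRainbow c) : rx3 G ≤ n :=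
  iInf₂_le n ⟨c, hc⟩

theorem rx3_eq_top_or : rx3 G = ⊤ ∨
    ∃ (n : ℕ) (c : G.edgeSet → Fin n), IsThreeRainbow c ∧ rx3 G = n := by
  classical
  by_cases h : ∃ (n : ℕ) (c : G.edgeSet → Fin n), IsThreeRainbow c
  · right
    obtain ⟨c, hc⟩ := Nat.find_spec h
    refine ⟨Nat.find h, c, hc, le_antisymm (rx3_le hc) (le_iInf₂ fun n hn => ?_)⟩
    exact Nat.cast_le.2 (Nat.find_min' h hn)
  · left
    exact iInf₂_eq_top.2 fun n hn => (h ⟨n, hn⟩).elim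

theorem rx3_le_add_six [Fintype V] [DecidableRel G.Adj] {D : Set V}
    (hD : IsConnectedWayDominating G 3 D) : rx3 G ≤ rx3 (G.induce D) + 6 := by
  obtain h | ⟨n, b, hb, h⟩ := rx3_eq_top_or (G := G.induce D)
  · rw [h, top_add]; exact le_top
  · obtain ⟨c, hc⟩ := exists_isThreeRainbow_add_six hD.dominating
      (fun v hv => by convert hD.le_degree v hv) b hb
    rw [h]
    exact_mod_cast rx3_le hc

end

/-! ### The windmill needs six colors -/

section Windmill

variable {t : ℕ}

theorem windmill_adj {x y : Option (Fin t × Fin 3)} :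
    (windmill t).Adj x y ↔ x ≠ y ∧ ∀ p ∈ x, ∀ q ∈ y, p.1 = q.1 := by
  rw [windmill, fromRel_adj]
  refine and_congr_right fun _ => or_iff_left_of_imp fun h p hp q hq => (h q hq p hp).symm

theorem windmill_adj_none (p : Fin t × Fin 3) : (windmill t).Adj (some p) none := by
  simp [windmill_adj]

theorem windmill_adj_some {i : Fin t} {j k : Fin 3} (h : j ≠ k) :
    (windmill t).Adj (some (i, j)) (some (i, k)) := by
  simp [windmill_adj, h]

theorem windmill_connected (t : ℕ) : (windmill t).Connected := by
  rw [connected_iff_exists_forall_reachable]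
  refine ⟨none, fun x => ?_⟩
  cases x with
  | none => exact Reachable.refl _
  | some p => exact (windmill_adj_none p).symm.reachable

theorem fin_three_facts : ∀ j : Fin 3, j ≠ j + 1 ∧ j ≠ j + 2 ∧ j + 2 + 1 = j ∧
    j + 2 + 2 = j + 1 ∧ j + 1 + 1 = j + 2 ∧ j + 1 + 2 = j := by decide

theorem fin_three_eq_add : ∀ j k : Fin 3, j ≠ k → k = j + 1 ∨ k = j + 2 := by decide

theorem fin_three_eq_of_add : ∀ j k : Fin 3, j + 1 = k + 2 → j + 2 = k + 1 → j = k := by decide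

theorem inl_mem_inl : ∀ k : Fin 3, (.inl k : Fin 3 ⊕ Fin 3) ∈
    ({.inl 0, .inl 1, .inl 2} : Finset (Fin 3 ⊕ Fin 3)) := by decide

theorem windmill_isConnectedWayDominating (t : ℕ) :
    IsConnectedWayDominating (windmill t) 3 {none} where
  dominating v hv := by
    cases v with
    | none => exact (hv rfl).elim
    | some p => exact ⟨none, rfl, windmill_adj_none p⟩
  le_degree v hv := by
    cases v with
    | none => exact (hv rfl).elim
    | some p =>
      obtain ⟨i, j⟩ := p
      rw [← card_neighborFinset_eq_degree]
      have h : ({none, some (i, j + 1), some (i, j + 2)} : Finset (Option (Fin t × Fin 3))) ⊆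
          (windmill t).neighborFinset (some (i, j)) := by
        intro x hx
        rw [mem_neighborFinset]
        simp only [Finset.mem_insert, Finset.mem_singleton] at hx
        obtain rfl | rfl | rfl := hx
        · exact windmill_adj_none _
        · exact windmill_adj_some (fin_three_facts j).1
        · exact windmill_adj_some (fin_three_facts j).2.1
      refine le_trans ?_ (Finset.card_le_card h)
      rw [Finset.card_eq_three.2 ⟨_, _, _, by simp, by simp, ?_, rfl⟩]
      simp
  connected := ⟨Preconnected.of_subsingleton⟩

theorem rx3_eq_zero_of_subsingleton {V : Type*} [Subsingleton V] (G : SimpleGraph V) :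
    rx3 G = 0 := by
  have hE : IsEmpty G.edgeSet := ⟨fun ⟨e, he⟩ => by
    induction e with
    | _ x y => exact G.ne_of_adj he (Subsingleton.elim _ _)⟩
  refine le_antisymm (rx3_le (n := 0) (c := fun e => hE.elim e) fun u v w => ?_) bot_le
  refine ⟨G.singletonSubgraph u, IsTree.coe_singletonSubgraph G u, fun e => hE.elim e, ?_⟩
  intro x _
  exact Subsingleton.elim _ _

/-- A connected subgraph that meets a set and its complement has an edge leaving the set. -/
theorem exists_adj_of_connected {V : Type*} {G : SimpleGraph V} {T : G.Subgraph}
    (hT : T.coe.Connected) {S : Set V} {x y : V} (hx : x ∈ T.verts) (hy : y ∈ T.verts)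
    (hxS : x ∈ S) (hyS : y ∉ S) : ∃ a ∈ S, ∃ b ∉ S, T.Adj a b := by
  obtain ⟨q⟩ := hT.preconnected ⟨x, hx⟩ ⟨y, hy⟩
  obtain ⟨d, -, h1, h2⟩ := q.exists_boundary_dart (Subtype.val ⁻¹' S) hxS hyS
  exact ⟨_, h1, _, h2, d.adj⟩

/-- The edges of a copy of `K₄` in the windmill: `inl j` is the edge between the vertex `j` and the
center, `inr j` is the edge opposite to the vertex `j` in the triangle. -/
def copyEdge (i : Fin t) : Fin 3 ⊕ Fin 3 → (windmill t).edgeSet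
  | .inl j => ⟨s(some (i, j), none), windmill_adj_none _⟩
  | .inr j => ⟨s(some (i, j + 1), some (i, j + 2)), windmill_adj_some (by revert j; decide)⟩

theorem copyEdge_injective (i i' : Fin t) (e e' : Fin 3 ⊕ Fin 3)
    (h : copyEdge i e = copyEdge i' e') : i = i' ∧ e = e' := by
  have h := congrArg Subtype.val h
  obtain j | j := e <;> obtain j' | j' := e'
  · simpa [copyEdge] using h
  · simp [copyEdge] at h
  · simp [copyEdge] at h
  · simp only [copyEdge, Sym2.eq_iff, Option.some.injEq, Prod.mk.injEq] at h
    refine ⟨h.elim (fun h => h.1.1) fun h => h.1.1, congrArg _ ?_⟩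
    obtain ⟨⟨-, h⟩, -⟩ | ⟨⟨-, h1⟩, -, h2⟩ := h
    · exact add_right_cancel h
    · exact fin_three_eq_of_add _ _ h1 h2

/-- In a connected subgraph containing a vertex of a copy and a vertex outside the copy, there is
an edge at that vertex. -/
theorem exists_copyEdge_at {T : (windmill t).Subgraph} (hT : T.coe.Connected) {i i' : Fin t}
    (hi : i' ≠ i) {j : Fin 3} (h : some (i, j) ∈ T.verts) (h' : some (i', j) ∈ T.verts) :
    ∃ e ∈ ({.inl j, .inr (j + 1), .inr (j + 2)} : Finset (Fin 3 ⊕ Fin 3)),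
      (copyEdge i e).1 ∈ T.edgeSet := by
  obtain ⟨_, rfl, b, hb, hab⟩ := exists_adj_of_connected hT h h' (S := {some (i, j)}) rfl
    (by simp [hi])
  have hadj := T.adj_sub hab
  cases b with
  | none => exact ⟨.inl j, by simp, hab⟩
  | some q =>
    obtain ⟨i₁, k⟩ := q
    obtain ⟨hne, h1⟩ := windmill_adj.1 hadj
    obtain rfl : i = i₁ := h1 _ rfl _ rfl
    have hjk : j ≠ k := fun e => hne (by rw [e])
    obtain ⟨-, -, e1, e2, e3, e4⟩ := fin_three_facts j
    obtain rfl | rfl := fin_three_eq_add j k hjk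
    · refine ⟨.inr (j + 2), by simp, ?_⟩
      simp only [copyEdge, e1, e2]
      exact hab
    · refine ⟨.inr (j + 1), by simp, ?_⟩
      simp only [copyEdge, e3, e4]
      exact hab.symm

/-- In a connected subgraph containing a vertex of a copy and a vertex outside the copy, there is
an edge of that copy at the center. -/
theorem exists_copyEdge_center {T : (windmill t).Subgraph} (hT : T.coe.Connected) {i i' : Fin t}
    (hi : i' ≠ i) {j : Fin 3} (h : some (i, j) ∈ T.verts) (h' : some (i', j) ∈ T.verts) :
    ∃ e ∈ ({.inl 0, .inl 1, .inl 2} : Finset (Fin 3 ⊕ Fin 3)),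
      (copyEdge i e).1 ∈ T.edgeSet := by
  obtain ⟨_, ⟨k, rfl⟩, b, hb, hab⟩ := exists_adj_of_connected hT h h'
    (S := Set.range fun k : Fin 3 => some (i, k)) ⟨j, rfl⟩ (by simp [hi.symm])
  have hadj := T.adj_sub hab
  cases b with
  | none => exact ⟨.inl k, inl_mem_inl k, hab⟩
  | some q =>
    obtain ⟨i₁, k'⟩ := q
    obtain rfl : i = i₁ := (windmill_adj.1 hadj).2 _ rfl _ rfl
    exact (hb ⟨k', rfl⟩).elim

/-- Used to turn "one edge in each of three copies, of distinct types" into "all three available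
types occur". -/
theorem subset_of_three_injective {α ι : Type*} [DecidableEq α] {s : Finset α} (hs : s.card ≤ 3)
    {I : Finset ι} (hI : I.card = 3) {f : ι → α} (hf : ∀ i ∈ I, f i ∈ s)
    (hinj : Set.InjOn f I) : ∀ x ∈ s, ∃ i ∈ I, f i = x := by
  have h := Finset.eq_of_subset_of_card_le (s := I.image f) (t := s)
    (Finset.image_subset_iff.2 hf) (by rw [Finset.card_image_of_injOn hinj, hI]; exact hs)
  intro x hx
  exact Finset.mem_image.1 (h ▸ hx)

theorem six_le_of_isThreeRainbow (ht : 2 * 5 ^ 6 + 1 ≤ t) {n : ℕ}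
    {c : (windmill t).edgeSet → Fin n} (hc : IsThreeRainbow c) : 6 ≤ n := by
  by_contra! hn
  let pat : Fin t → Fin 3 ⊕ Fin 3 → Fin n := fun i e => c (copyEdge i e)
  -- There are at most `5 ^ 6` patterns, so more than twice as many copies put three of them on one
  -- pattern.
  have hcard : Fintype.card (Fin 3 ⊕ Fin 3 → Fin n) * 2 < Fintype.card (Fin t) := by
    have h1 : n ^ 6 ≤ 5 ^ 6 := Nat.pow_le_pow_left (by omega) 6
    simp only [Fintype.card_pi, Finset.prod_const, Fintype.card_fin, Finset.card_univ,
      Fintype.card_sum, Nat.reduceAdd]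
    omega
  obtain ⟨φ, hφ⟩ := Fintype.exists_lt_card_fiber_of_mul_lt_card pat hcard
  obtain ⟨I, hI, hI3⟩ := Finset.exists_subset_card_eq (Nat.succ_le_of_lt hφ)
  have hpat : ∀ i ∈ I, ∀ e, c (copyEdge i e) = φ e := fun i hi e =>
    congrFun (Finset.mem_filter.1 (hI hi)).2 e
  obtain ⟨a, b, d, hab, had, hbd, rfl⟩ := Finset.card_eq_three.1 hI3
  have key : ∀ j : Fin 3, ∃ F : Set (Fin 3 ⊕ Fin 3), Set.InjOn φ F ∧
      (∀ k, .inl k ∈ F) ∧ .inr (j + 1) ∈ F ∧ .inr (j + 2) ∈ F := fun j => by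
    obtain ⟨T, hT, hTR, hTS⟩ := hc (some (a, j)) (some (b, j)) (some (d, j))
    have hTv : ∀ i ∈ ({a, b, d} : Finset (Fin t)), some (i, j) ∈ T.verts := fun i hi => by
      simp only [Finset.mem_insert, Finset.mem_singleton] at hi
      obtain rfl | rfl | rfl := hi <;> exact hTS (by simp)
    have hother : ∀ i ∈ ({a, b, d} : Finset (Fin t)), ∃ i' ∈ ({a, b, d} : Finset (Fin t)),
        i' ≠ i := fun i hi => by
      simp only [Finset.mem_insert, Finset.mem_singleton] at hi
      obtain rfl | rfl | rfl := hi
      · exact ⟨b, by simp, hab.symm⟩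
      · exact ⟨a, by simp, hab⟩
      · exact ⟨a, by simp, had⟩
    have heq : ∀ i ∈ ({a, b, d} : Finset (Fin t)), ∀ i' ∈ ({a, b, d} : Finset (Fin t)), ∀ e e',
        (copyEdge i e).1 ∈ T.edgeSet → (copyEdge i' e').1 ∈ T.edgeSet → φ e = φ e' →
        i = i' ∧ e = e' := fun i hi i' hi' e e' h h' hee => by
      refine copyEdge_injective i i' e e' (hTR _ _ h h' ?_)
      rw [hpat i hi, hpat i' hi', hee]
    -- Edges of one type in different copies share a color, so a rainbow tree uses each type at most
    -- once. Applied to the edges at the vertex `j` and to those at the center, this yields every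
    -- type except `inr j`.
    have hall : ∀ s : Finset (Fin 3 ⊕ Fin 3), s.card ≤ 3 →
        (∀ i ∈ ({a, b, d} : Finset (Fin t)), ∃ e ∈ s, (copyEdge i e).1 ∈ T.edgeSet) →
        ∀ e ∈ s, ∃ i ∈ ({a, b, d} : Finset (Fin t)), (copyEdge i e).1 ∈ T.edgeSet :=
      fun s hs h e he => by
        have : Nonempty (Fin 3 ⊕ Fin 3) := ⟨e⟩
        choose! f hf hfT using h
        obtain ⟨i, hi, rfl⟩ := subset_of_three_injective hs hI3 hf
          (fun i hi i' hi' hii => (heq i hi i' hi' _ _ (hfT i hi) (hfT i' hi')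
            (congrArg φ hii)).1) e he
        exact ⟨i, hi, hfT i hi⟩
    have h1 := hall {.inl j, .inr (j + 1), .inr (j + 2)} Finset.card_le_three fun i hi => by
      obtain ⟨i', hi', hne⟩ := hother i hi
      exact exists_copyEdge_at hT.connected hne (hTv i hi) (hTv i' hi')
    have h2 := hall {.inl 0, .inl 1, .inl 2} Finset.card_le_three fun i hi => by
      obtain ⟨i', hi', hne⟩ := hother i hi
      exact exists_copyEdge_center hT.connected hne (hTv i hi) (hTv i' hi')
    refine ⟨{e | ∃ i ∈ ({a, b, d} : Finset (Fin t)), (copyEdge i e).1 ∈ T.edgeSet}, ?_,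
      fun k => h2 _ (inl_mem_inl k), h1 (.inr (j + 1)) (by simp), h1 (.inr (j + 2)) (by simp)⟩
    rintro e ⟨i, hi, he⟩ e' ⟨i', hi', he'⟩ hee
    exact (heq i hi i' hi' e e' he he' hee).2
  have hinj : Function.Injective φ := by
    -- Any two edge types are compared using an index `j` whose opposite edge is neither of them.
    have hcase : ∀ k k' : Fin 3, ∃ j : Fin 3, (k = j + 1 ∨ k = j + 2) ∧
        (k' = j + 1 ∨ k' = j + 2) := by decide
    intro e e' hee
    obtain ⟨k, k', hk, hk'⟩ : ∃ k k' : Fin 3, (e = .inr k ∨ ∃ m, e = .inl m) ∧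
        (e' = .inr k' ∨ ∃ m, e' = .inl m) := by
      obtain m | m := e <;> obtain m' | m' := e'
      · exact ⟨0, 0, .inr ⟨m, rfl⟩, .inr ⟨m', rfl⟩⟩
      · exact ⟨0, m', .inr ⟨m, rfl⟩, .inl rfl⟩
      · exact ⟨m, 0, .inl rfl, .inr ⟨m', rfl⟩⟩
      · exact ⟨m, m', .inl rfl, .inl rfl⟩
    obtain ⟨j, hj, hj'⟩ := hcase k k'
    obtain ⟨F, hF, hl, h1, h2⟩ := key j
    have hmem : ∀ {e : Fin 3 ⊕ Fin 3} {k : Fin 3}, (e = .inr k ∨ ∃ m, e = .inl m) →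
        (k = j + 1 ∨ k = j + 2) → e ∈ F := by
      rintro e k (rfl | ⟨m, rfl⟩) (rfl | rfl)
      exacts [h1, h2, hl m, hl m]
    exact hF (hmem hk hj) (hmem hk' hj') hee
  have := Fintype.card_le_of_injective φ hinj
  simp only [Fintype.card_sum, Fintype.card_fin] at this
  omega

end Windmill

end RainbowIndex

open RainbowIndex in
theorem theorem3 :
    (∀ (V : Type u) [Fintype V] (G : SimpleGraph V) [DecidableRel G.Adj] (D : Set V),
      G.Connected → IsConnectedWayDominating G 3 D →
        rx3 G ≤ rx3 (G.induce D) + 6) ∧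
    (∀ t : ℕ, 2 * 5 ^ 6 + 1 ≤ t →
      (windmill t).Connected ∧
      IsConnectedWayDominating (windmill t) 3 {none} ∧
      rx3 ((windmill t).induce {none}) = 0 ∧
      rx3 (windmill t) = rx3 ((windmill t).induce {none}) + 6) := by
  refine ⟨fun V _ G _ D _ hD => rx3_le_add_six hD, fun t ht => ⟨windmill_connected t,
    windmill_isConnectedWayDominating t, rx3_eq_zero_of_subsingleton _, ?_⟩⟩
  refine le_antisymm (rx3_le_add_six (windmill_isConnectedWayDominating t)) ?_
  rw [rx3_eq_zero_of_subsingleton, zero_add]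
  refine le_iInf₂ fun n ⟨c, hc⟩ => ?_
  exact_mod_cast six_le_of_isThreeRainbow ht hc
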